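/- Let $n \ge 3$ and let $(M,g)$ be a complete connected smooth Riemannian $n$-manifold which is the union of a compact part and finitely many pairwise disjoint open ends $E_\ell$, each diffeomorphic to $(0,\infty)\times N_\ell$ with $N_\ell$ a closed $(n-1)$-manifold; let $s$ be the coordinate on $(0,\infty)$, and suppose that $M \setminus \bigcup_\ell \{s > a \text{ on } E_\ell\}$ is compact for every $a>0$. Suppose that every end is asymptotically cylindrical (AC) or asymptotically periodic (AP): there are a reference metric $\hat g_\ell$ on $\mathbb{R}\times N_\ell$ and a number $\omega_\ell>0$ such that, with $\hat\nabla$ and the norm taken with respect to $\hat g_\ell$, $|\hat\nabla^k(g-\hat g_\ell)| = O(e^{-\omega_\ell s})$ on the part $\{s\ge 1\}$ of $E_\ell$ for all $k\ge 0$, where $\hat g_\ell = ds^2 + h_\ell$ with $h_\ell$ a Riemannian metric on $N_\ell$ in the AC case, and $\hat g_\ell$ is invariant under $(s,x)\mapsto(s+T_\ell,x)$ for some $T_\ell>0$ in the AP case. Let $t\ge 0$ be a smooth function on $M$ which vanishes off the ends and satisfies $C_1(1+t) \le 1+\mathrm{dist}(\cdot,\partial E_\ell) \le C_2(1+t)$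 on each $E_\ell$ for some constants $0<C_1<C_2$. For $0<\mu<1$, let $C^{2,\mu}$ be the space of $C^2$ functions $f$ on $M$ for which $|f|$, $|\nabla f|$, $|\nabla^2 f|$ and the $\mu$-Hölder seminorm of $\nabla^2 f$ on balls of radius $1$ (values at two points being compared by parallel transport along minimizing geodesics) are bounded uniformly over all such balls, and let $C^{2,\mu}_{\delta} = \{f : e^{-\delta t} f\in C^{2,\mu}\}$. Suppose that the scalar curvature satisfies $R\ge R_0$ for a constant $R_0>0$, and that $\beta = \frac{n-2}{4n}\tau^2 - \frac{n-2}{2(n-1)}\Lambda \ge \beta_0$ for a function $\tau$ on $M$ and constants $\Lambda\ge 0$, $\beta_0>0$. Let $\omega>0$ and let $\tilde\sigma$ be a symmetric $2$-tensor field on $M$ such that on each $E_\ell$ there is a function $\mathring\sigma_\ell^2$ on $\mathbb{R}\times N_\ell$, independent of $s$ if the end is AC and $T_\ell$-periodic in $s$ if it is AP, with $\big||\tilde\sigma|_g^2-\mathring\sigma_\ell^2\big| = O(e^{-\omega t})$ on the part $\{s\ge 1\}$ of $E_\ell$. Let $\phi_1,\phi_2\in C^{2,\mu}$ be positive and bounded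 away from zero, and let both be solutions of the Lichnerowicz equation $$\Delta\phi - c_n R\phi - \beta\phi^\alpha + c_n|\tilde\sigma|^2\phi^{-\gamma} = 0,\qquad c_n=\frac{n-2}{4(n-1)},\quad \alpha=\frac{n+2}{n-2},\quad \gamma=\frac{3n-2}{n-2},$$ where $\Delta = \mathrm{tr}_g\nabla^2$. If $\phi_2-\phi_1\in C^{2,\mu}_{-\omega}$, then $\phi_1=\phi_2$. -/

import Mathlib

open scoped Manifold ContDiff Bundle

noncomputable section

namespace LichUnique

/-! ### Tensor calculus of a metric, in charts -/

section Calculus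

variable {E : Type*} [NormedAddCommGroup E] [NormedSpace ℝ E]
  {H : Type*} [TopologicalSpace H] (I : ModelWithCorners ℝ E H)
  {X : Type*} [TopologicalSpace X] [ChartedSpace H X]

/-- Covariant tensor fields of rank `r` (multilinearity is a property of the fields used below).
Rank `2` fields `g` serve as metrics. -/
abbrev TensorField (X : Type*) [TopologicalSpace X] [ChartedSpace H X] (r : ℕ) : Type _ :=
  ∀ p : X, (Fin r → TangentSpace I p) → ℝ

/-- The tangent vector, at the point with coordinates `y` in the preferred chart at `p`, whose
coordinates are `v`. With `v` fixed this is a coordinate vector field near `p`. Its value at `p`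
itself is `v`, since a tangent vector at `p` is by definition given by its coordinates in the
preferred chart at `p`. -/
def coordVec (p : X) (y v : E) : TangentSpace I ((extChartAt I p).symm y) :=
  mfderiv 𝓘(ℝ, E) I (extChartAt I p).symm y v

/-- The coefficients `g (∂_u, ∂_v)` of a metric in the preferred chart at `p`. -/
def coordMetric (g : TensorField I X 2) (p : X) (y u v : E) : ℝ :=
  g ((extChartAt I p).symm y) ![coordVec I p y u, coordVec I p y v]

/-- The Christoffel symbols of the Levi-Civita connection of `g` in the preferred chart at `p`:
`Γ(u, v) = ∇_{∂_u} ∂_v` is the vector `w` with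
`g (w, z) = (∂_u g (v, z) + ∂_v g (u, z) - ∂_z g (u, v)) / 2` for all `z`. -/
def christoffel (g : TensorField I X 2) (p : X) (y u v : E) : E :=
  Classical.epsilon fun w : E => ∀ z : E,
    coordMetric I g p y w z =
      (fderiv ℝ (fun y' => coordMetric I g p y' v z) y u
        + fderiv ℝ (fun y' => coordMetric I g p y' u z) y v
        - fderiv ℝ (fun y' => coordMetric I g p y' u v) y z) / 2

/-- The covariant derivative of a tensor field:
`(∇T)(v₀, v₁, …, v_r) = ∂_{v₀} (T (v₁, …, v_r)) - ∑ₐ T (v₁, …, Γ(v₀, vₐ), …, v_r)`. -/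
def covDeriv (g : TensorField I X 2) {r : ℕ} (T : TensorField I X r) : TensorField I X (r + 1) :=
  fun p v =>
    fderiv ℝ (fun y : E => T ((extChartAt I p).symm y)
        (fun a => coordVec I p y (v a.succ : E))) (extChartAt I p p) (v 0 : E)
      - ∑ a : Fin r, T p (Function.update (fun b => v b.succ) a
          (christoffel I g p (extChartAt I p p) (v 0 : E) (v a.succ : E) : E))

/-- The `k`-th covariant derivative. -/
def iterCovDeriv (g : TensorField I X 2) {r : ℕ} (T : TensorField I X r) :
    (k : ℕ) → TensorField I X (r + k)
  | 0 => T
  | k + 1 => covDeriv I g (iterCovDeriv g T k)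

/-- `|T|_g ≤ C` at the point `p`, for the operator norm of a tensor. -/
def TensorNormLE (g : TensorField I X 2) {r : ℕ} (T : TensorField I X r) (p : X) (C : ℝ) : Prop :=
  ∀ v : Fin r → TangentSpace I p, |T p v| ≤ C * ∏ a, √(g p ![v a, v a])

/-- The differential `∇f` of a function. -/
def differential (f : X → ℝ) : TensorField I X 1 :=
  fun p v => fderiv ℝ (fun y : E => f ((extChartAt I p).symm y)) (extChartAt I p p) (v 0 : E)

/-- The Hessian `∇²f (u, v) = ∂_u ∂_v f - (Γ(u, v)) f` of a function. -/
def hessian (g : TensorField I X 2) (f : X → ℝ) : TensorField I X 2 :=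
  fun p v =>
    fderiv ℝ (fun y : E => fderiv ℝ (fun y' : E => f ((extChartAt I p).symm y')) y (v 1 : E))
        (extChartAt I p p) (v 0 : E)
      - fderiv ℝ (fun y : E => f ((extChartAt I p).symm y)) (extChartAt I p p)
          (christoffel I g p (extChartAt I p p) (v 0 : E) (v 1 : E))

/-- The curvature `R(u, v) w = ∇_u ∇_v w - ∇_v ∇_u w` on coordinate vector fields. -/
def curvature (g : TensorField I X 2) (p : X) (u v w : E) : E :=
  let y := extChartAt I p p
  fderiv ℝ (fun y' => christoffel I g p y' v w) y u
    - fderiv ℝ (fun y' => christoffel I g p y' u w) y v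
    + christoffel I g p y u (christoffel I g p y v w)
    - christoffel I g p y v (christoffel I g p y u w)

end Calculus

/-! ### Riemannian manifolds -/

section Riemannian

variable (n : ℕ) (M : Type*) [MetricSpace M] [ChartedSpace (EuclideanSpace ℝ (Fin n)) M]
  [Bundle.RiemannianBundle (fun p : M => TangentSpace (𝓡 n) p)]

/-- The metric tensor of a Riemannian manifold. -/
def metricTensor : TensorField (𝓡 n) M 2 := fun _ v => inner ℝ (v 0) (v 1)

variable {M}

instance (p : M) : FiniteDimensional ℝ (TangentSpace (𝓡 n) p) :=
  inferInstanceAs (FiniteDimensional ℝ (EuclideanSpace ℝ (Fin n)))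

/-- An orthonormal basis of the tangent space. -/
def frame (p : M) : OrthonormalBasis (Fin (Module.finrank ℝ (TangentSpace (𝓡 n) p))) ℝ
    (TangentSpace (𝓡 n) p) :=
  stdOrthonormalBasis ℝ (TangentSpace (𝓡 n) p)

/-- The Laplace-Beltrami operator `Δf = tr ∇²f` (a nonpositive operator). -/
def laplacian (f : M → ℝ) (p : M) : ℝ :=
  ∑ i, hessian (𝓡 n) (metricTensor n M) f p ![frame n p i, frame n p i]

/-- The scalar curvature `∑ᵢⱼ ⟨R(eᵢ, eⱼ) eⱼ, eᵢ⟩`. -/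
def scalarCurvature (p : M) : ℝ :=
  let e : Fin _ → TangentSpace (𝓡 n) p := frame n p
  ∑ i, ∑ j, metricTensor n M p
    ![(curvature (E := EuclideanSpace ℝ (Fin n)) (𝓡 n) (metricTensor n M) p (e i) (e j) (e j) :
      EuclideanSpace ℝ (Fin n)), e i]

/-- The square `|S|²` of the norm of a `2`-tensor. -/
def normSq (S : ∀ p : M, TangentSpace (𝓡 n) p →ₗ[ℝ] TangentSpace (𝓡 n) p →ₗ[ℝ] ℝ) (p : M) : ℝ :=
  ∑ i, ∑ j, (S p (frame n p i) (frame n p j)) ^ 2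

/-- A minimizing curve on `[0, 1]`: its length is the distance of its end points. -/
def IsMinimizing (γ : ℝ → M) : Prop :=
  ContMDiffOn 𝓘(ℝ, ℝ) (𝓡 n) 1 γ (Set.Icc 0 1) ∧
    Manifold.pathELength (𝓡 n) γ 0 1 = edist (γ 0) (γ 1)

/-- A parallel vector field along a curve on `[0, 1]`: `V' + Γ(γ', V) = 0` at every time `s`, in the
preferred chart at `γ s`. -/
def IsParallel (γ : ℝ → M) (V : ∀ s, TangentSpace (𝓡 n) (γ s)) : Prop :=
  ∀ s ∈ Set.Icc (0 : ℝ) 1,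
    HasDerivWithinAt
      (fun s' => (mfderiv (𝓡 n) 𝓘(ℝ, EuclideanSpace ℝ (Fin n)) (extChartAt (𝓡 n) (γ s)) (γ s')
        (V s') : EuclideanSpace ℝ (Fin n)))
      (-(christoffel (𝓡 n) (metricTensor n M) (γ s) (extChartAt (𝓡 n) (γ s) (γ s))
          (derivWithin (fun s' => extChartAt (𝓡 n) (γ s) (γ s')) (Set.Icc 0 1) s)
          (V s : EuclideanSpace ℝ (Fin n))))
      (Set.Icc 0 1) s

/-- The Hölder seminorm of exponent `μ` of the tensor `T` on every unit ball is at most `C`: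
`|T(x) - T(y)| ≤ C d(x, y)^μ` for `x, y` in a common unit ball, where the tensors at `x` and at `y`
are compared by parallel transport along minimizing curves from `x` to `y`. -/
def HolderSeminormLE (μ : ℝ) {r : ℕ} (T : TensorField (𝓡 n) M r) (C : ℝ) : Prop :=
  ∀ (q : M) (γ : ℝ → M), IsMinimizing n γ → γ 0 ∈ Metric.ball q 1 → γ 1 ∈ Metric.ball q 1 →
    ∀ V : Fin r → ∀ s, TangentSpace (𝓡 n) (γ s), (∀ a, IsParallel n γ (V a)) →
      |T (γ 0) (fun a => V a 0) - T (γ 1) (fun a => V a 1)|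
        ≤ C * dist (γ 0) (γ 1) ^ μ * ∏ a, ‖V a 0‖

/-- The space `C^{2,μ}` of the functions `f` of class `C²` with finite norm
`sup |f| + sup |∇f| + sup |∇²f| + [∇²f]_μ`, the suprema being uniform over all unit balls. -/
def MemHolder (μ : ℝ) (f : M → ℝ) : Prop :=
  ContMDiff (𝓡 n) 𝓘(ℝ, ℝ) 2 f ∧ ∃ C : ℝ,
    (∀ p, |f p| ≤ C) ∧
    (∀ p, TensorNormLE (𝓡 n) (metricTensor n M) (differential (𝓡 n) f) p C) ∧
    (∀ p, TensorNormLE (𝓡 n) (metricTensor n M) (hessian (𝓡 n) (metricTensor n M) f) p C) ∧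
    HolderSeminormLE n μ (hessian (𝓡 n) (metricTensor n M) f) C

/-- The weighted space `C^{2,μ}_δ`, with norm `‖e^{-δt} f‖_{2,μ}`. -/
def MemWeightedHolder (t : M → ℝ) (μ δ : ℝ) (f : M → ℝ) : Prop :=
  MemHolder n μ fun p => Real.exp (-δ * t p) * f p

end Riemannian

/-! ### Ends of cylindrical type -/

/-- The model with corners of the cylinder `ℝ × N`, where `N` has dimension `n - 1`. -/
abbrev cylModel (n : ℕ) : ModelWithCorners ℝ (ℝ × EuclideanSpace ℝ (Fin (n - 1)))
    (ModelProd ℝ (EuclideanSpace ℝ (Fin (n - 1)))) :=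
  𝓘(ℝ, ℝ).prod (𝓡 (n - 1))

/-- A decomposition of `M` into a compact part and finitely many pairwise disjoint open ends
`E_ℓ`, each with a diffeomorphism `(0, ∞) × N_ℓ → E_ℓ`. -/
structure EndDecomposition (n : ℕ) (M : Type*) [MetricSpace M]
    [ChartedSpace (EuclideanSpace ℝ (Fin n)) M] {ι : Type*} (N : ι → Type*)
    [∀ ℓ, TopologicalSpace (N ℓ)] [∀ ℓ, ChartedSpace (EuclideanSpace ℝ (Fin (n - 1))) (N ℓ)] where
  param : ∀ ℓ, OpenPartialHomeomorph (ℝ × N ℓ) M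
  source_eq : ∀ ℓ, (param ℓ).source = Set.Ioi 0 ×ˢ Set.univ
  smooth : ∀ ℓ, ContMDiffOn (cylModel n) (𝓡 n) ∞ (param ℓ) (param ℓ).source
  smooth_symm : ∀ ℓ, ContMDiffOn (𝓡 n) (cylModel n) ∞ (param ℓ).symm (param ℓ).target
  disjoint : Pairwise fun ℓ ℓ' => Disjoint (param ℓ).target (param ℓ').target
  compact_core : ∀ a : ℝ, 0 < a →
    IsCompact (⋃ ℓ, param ℓ '' (Set.Ioi a ×ˢ Set.univ))ᶜ

namespace EndDecomposition

variable {n : ℕ} {M : Type*} [MetricSpace M] [ChartedSpace (EuclideanSpace ℝ (Fin n)) M]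
  {ι : Type*} {N : ι → Type*} [∀ ℓ, TopologicalSpace (N ℓ)]
  [∀ ℓ, ChartedSpace (EuclideanSpace ℝ (Fin (n - 1))) (N ℓ)]
  (D : EndDecomposition n M N)

/-- The end `E_ℓ`. -/
def endSet (ℓ : ι) : Set M := (D.param ℓ).target

/-- A radial function: smooth, nonnegative, zero off the ends, and comparable on every end to the
distance from the boundary of the end. -/
structure IsRadial (t : M → ℝ) : Prop where
  smooth : ContMDiff (𝓡 n) 𝓘(ℝ, ℝ) ∞ t
  nonneg : ∀ p, 0 ≤ t p
  eq_zero : ∀ p, (∀ ℓ, p ∉ D.endSet ℓ) → t p = 0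
  comparable : ∀ ℓ, ∃ C₁ C₂ : ℝ, 0 < C₁ ∧ C₁ < C₂ ∧ ∀ p ∈ D.endSet ℓ,
    C₁ * (1 + t p) ≤ 1 + Metric.infDist p (frontier (D.endSet ℓ)) ∧
    1 + Metric.infDist p (frontier (D.endSet ℓ)) ≤ C₂ * (1 + t p)

variable [Bundle.RiemannianBundle (fun p : M => TangentSpace (𝓡 n) p)]

/-- The metric of `M` on the end `E_ℓ`, read on the cylinder `(0, ∞) × N_ℓ`. -/
def pulledMetric (ℓ : ι) : TensorField (cylModel n) (ℝ × N ℓ) 2 := fun p v =>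
  metricTensor n M (D.param ℓ p) fun a => mfderiv (cylModel n) (𝓡 n) (D.param ℓ) p (v a)

/-- All derivatives of `g - g'` are `O(e^{-κs})` on the end, in the sense of the metric `g'` on the
cylinder, `s` being the coordinate on `(0, ∞)`. -/
def DecaysTo (ℓ : ι) (g' : TensorField (cylModel n) (ℝ × N ℓ) 2) (κ : ℝ) : Prop :=
  ∀ k : ℕ, ∃ C : ℝ, ∀ (s : ℝ) (x : N ℓ), 1 ≤ s →
    TensorNormLE (cylModel n) g'
      (iterCovDeriv (cylModel n) g' (fun p v => D.pulledMetric ℓ p v - g' p v) k)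
      (s, x) (C * Real.exp (-κ * s))

/-- The end `E_ℓ` is asymptotically cylindrical: the metric decays exponentially, with all
derivatives, to a product metric `ds² + h`, where `h` is a Riemannian metric on `N_ℓ`. -/
def IsAC [∀ ℓ, IsManifold (𝓡 (n - 1)) ∞ (N ℓ)] (ℓ : ι) : Prop :=
  ∃ (h : Bundle.ContMDiffRiemannianMetric (𝓡 (n - 1)) ∞ (EuclideanSpace ℝ (Fin (n - 1)))
      (fun x : N ℓ => TangentSpace (𝓡 (n - 1)) x)) (κ : ℝ), 0 < κ ∧
    D.DecaysTo ℓ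
      (fun p v =>
        let u : ℝ × TangentSpace (𝓡 (n - 1)) p.2 := v 0
        let w : ℝ × TangentSpace (𝓡 (n - 1)) p.2 := v 1
        u.1 * w.1 + h.inner p.2 u.2 w.2) κ

/-- The end `E_ℓ` is asymptotically periodic with period `T`: the metric decays exponentially, with
all derivatives, to a Riemannian metric on `ℝ × N_ℓ` which is invariant under the translation
`(s, x) ↦ (s + T, x)`. -/
def IsAP [∀ ℓ, IsManifold (𝓡 (n - 1)) ∞ (N ℓ)] (ℓ : ι) (T : ℝ) : Prop :=
  ∃ (h : Bundle.ContMDiffRiemannianMetric (cylModel n) ∞ (ℝ × EuclideanSpace ℝ (Fin (n - 1)))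
      (fun p : ℝ × N ℓ => TangentSpace (cylModel n) p)) (κ : ℝ), 0 < κ ∧
    (∀ (p : ℝ × N ℓ) (u w : TangentSpace (cylModel n) p),
      h.inner (p.1 + T, p.2)
        (mfderiv (cylModel n) (cylModel n) (fun q : ℝ × N ℓ => (q.1 + T, q.2)) p u)
        (mfderiv (cylModel n) (cylModel n) (fun q : ℝ × N ℓ => (q.1 + T, q.2)) p w)
        = h.inner p u w) ∧
    D.DecaysTo ℓ (fun p v => h.inner p (v 0) (v 1)) κ

/-- On the end `E_ℓ` the function `f` converges at the rate `e^{-κt}` to a limit on the cylinder,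
which does not depend on the coordinate `s` if the end is asymptotically cylindrical, and has
period `T` in `s` if the end is asymptotically periodic of period `T`. -/
def ConvergesOnEnd [∀ ℓ, IsManifold (𝓡 (n - 1)) ∞ (N ℓ)] (ℓ : ι) (T : ℝ) (t : M → ℝ) (κ : ℝ)
    (f : M → ℝ) : Prop :=
  ∃ L : ℝ × N ℓ → ℝ,
    ((D.IsAC ℓ ∧ ∀ s s' x, L (s, x) = L (s', x)) ∨
      (D.IsAP ℓ T ∧ ∀ s x, L (s + T, x) = L (s, x))) ∧
    ∃ C : ℝ, ∀ (s : ℝ) (x : N ℓ), 1 ≤ s →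
      |f (D.param ℓ (s, x)) - L (s, x)| ≤ C * Real.exp (-κ * t (D.param ℓ (s, x)))

end EndDecomposition

/-- The function `β = (n-2)/(4n) τ² - (n-2)/(2(n-1)) Λ`. -/
def betaFn {M : Type*} (n : ℕ) (τ : M → ℝ) (Lam : ℝ) (p : M) : ℝ :=
  ((n : ℝ) - 2) / (4 * n) * τ p ^ 2 - ((n : ℝ) - 2) / (2 * ((n : ℝ) - 1)) * Lam

/-- `φ` solves the Lichnerowicz equation
`Δφ - c_n R φ - β φ^α + c_n |S|² φ^{-γ} = 0`, with `c_n = (n-2)/(4(n-1))`, `α = (n+2)/(n-2)` and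
`γ = (3n-2)/(n-2)`. -/
def SolvesLichnerowicz (n : ℕ) {M : Type*} [MetricSpace M]
    [ChartedSpace (EuclideanSpace ℝ (Fin n)) M]
    [Bundle.RiemannianBundle (fun p : M => TangentSpace (𝓡 n) p)]
    (β : M → ℝ) (S : ∀ p : M, TangentSpace (𝓡 n) p →ₗ[ℝ] TangentSpace (𝓡 n) p →ₗ[ℝ] ℝ)
    (φ : M → ℝ) : Prop :=
  let c : ℝ := ((n : ℝ) - 2) / (4 * ((n : ℝ) - 1))
  let α : ℝ := ((n : ℝ) + 2) / ((n : ℝ) - 2)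
  let γ : ℝ := (3 * (n : ℝ) - 2) / ((n : ℝ) - 2)
  ∀ p, laplacian n φ p - c * scalarCurvature n p * φ p - β p * φ p ^ α
    + c * normSq n S p * φ p ^ (-γ) = 0

end LichUnique

end

/-! The proof is a maximum principle at an attained maximum. Suppose that `w = ψ - φ`, with `φ`, `ψ`
the two solutions in either order, is positive at `q`. As `exp (κ t) * w` is bounded, `t` is bounded
on `{w q ≤ w}`; if this set is compact, `w` has a maximum point `p`, and `w p > 0`. There `Δψ ≤ Δφ`,
while subtracting the two equations gives `Δψ - Δφ = c R (ψ - φ) + β (ψ^α - φ^α) + c |S|² (φ^(-γ) -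
ψ^(-γ)) > 0`, since `R > 0` and the other two terms are nonnegative: a contradiction
(`SolvesLichnerowicz.le_of_isMax_sub`).

Compactness has two ingredients. Sublevel sets of `t` are bounded, because `t` controls the distance
to the frontier of each end, which is nonempty and lies in the compact core
(`IsRadial.isBounded_sublevel`). Closed bounded sets are compact by Hopf-Rinow, proved for complete
locally compact length spaces (`HasIntermediatePoints.properSpace`). -/

namespace LichUnique

open Set Filter Topology

/-! ### Complete locally compact length spaces are proper -/

section LengthSpace

variable {X : Type*} [MetricSpace X]

/-- Points at distance less than `r + s` are joined through a point at distance at most `r` from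
the first and less than `s` from the second. -/
def HasIntermediatePoints (X : Type*) [MetricSpace X] : Prop :=
  ∀ (x y : X) (r s : ℝ), 0 ≤ r → 0 < s → dist x y < r + s →
    ∃ z, dist x z ≤ r ∧ dist z y < s

/-- Local compactness gives a compact thickening of the ball, and intermediate points place a
slightly larger ball inside it. -/
theorem HasIntermediatePoints.exists_isCompact_closedBall_add [LocallyCompactSpace X]
    (hX : HasIntermediatePoints X) (x : X) {r : ℝ} (hr : 0 ≤ r)
    (hc : IsCompact (Metric.closedBall x r)) :
    ∃ δ, 0 < δ ∧ IsCompact (Metric.closedBall x (r + δ)) := by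
  obtain ⟨δ, hδ, hK⟩ := hc.exists_isCompact_cthickening
  refine ⟨δ / 2, by positivity, hK.of_isClosed_subset Metric.isClosed_closedBall fun y hy => ?_⟩
  rw [Metric.mem_closedBall'] at hy
  obtain ⟨z, hz, hzy⟩ := hX x y r δ hr hδ (by linarith)
  exact Metric.mem_cthickening_of_dist_le y z δ _ (Metric.mem_closedBall'.2 hz)
    (by rw [dist_comm]; exact hzy.le)

theorem HasIntermediatePoints.isCompact_closedBall_of_lt [CompleteSpace X]
    (hX : HasIntermediatePoints X) (x : X) {R : ℝ} (hR : 0 < R)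
    (hc : ∀ r, 0 ≤ r → r < R → IsCompact (Metric.closedBall x r)) :
    IsCompact (Metric.closedBall x R) := by
  refine TotallyBounded.isCompact_of_isClosed ?_ Metric.isClosed_closedBall
  refine Metric.totallyBounded_iff.2 fun ε hε => ?_
  -- The margin `ε / 4` makes `R < r + ε / 2`, so every point of the `R`-ball is within `ε / 2` of
  -- the compact `r`-ball; an `ε / 2`-net of the latter is an `ε`-net of the former.
  set r := max (R - ε / 4) 0 with hrdef
  have hr : r < R := max_lt (by linarith) hR
  have hle : R - ε / 4 ≤ r := le_max_left _ _
  obtain ⟨t, htf, ht⟩ := Metric.totallyBounded_iff.1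
    (hc r (le_max_right _ _) hr).totallyBounded (ε / 2) (by positivity)
  refine ⟨t, htf, fun y hy => ?_⟩
  rw [Metric.mem_closedBall'] at hy
  obtain ⟨z, hz, hzy⟩ := hX x y r (ε / 2) (le_max_right _ _) (by positivity) (by linarith)
  have hz' := ht (Metric.mem_closedBall'.2 hz)
  simp only [mem_iUnion, Metric.mem_ball, exists_prop] at hz' ⊢
  obtain ⟨w, hw, hzw⟩ := hz'
  exact ⟨w, hw, by linarith [dist_triangle y z w, dist_comm y z]⟩

/-- The Hopf-Rinow-Cohn-Vossen theorem. -/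
theorem HasIntermediatePoints.properSpace [CompleteSpace X] [LocallyCompactSpace X]
    (hX : HasIntermediatePoints X) : ProperSpace X := by
  refine ProperSpace.of_isCompact_closedBall_of_le 0 fun x R hR => ?_
  by_contra hne
  -- If the radii of compact balls were bounded, their supremum would be such a radius and could
  -- still be increased.
  set S : Set ℝ := {r | 0 ≤ r ∧ IsCompact (Metric.closedBall x r)}
  have hdown : ∀ r r', r ∈ S → 0 ≤ r' → r' ≤ r → r' ∈ S := fun r r' h h0 h' =>
    ⟨h0, h.2.of_isClosed_subset Metric.isClosed_closedBall (Metric.closedBall_subset_closedBall h')⟩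
  have h0 : (0 : ℝ) ∈ S := ⟨le_rfl, by simp⟩
  have hbdd : BddAbove S := ⟨R, fun r hr => by
    by_contra! hlt
    exact hne (hdown r R hr hR hlt.le).2⟩
  have hs0 : 0 ≤ sSup S := le_csSup hbdd h0
  have hlt : ∀ r, 0 ≤ r → r < sSup S → IsCompact (Metric.closedBall x r) := fun r hr hrs => by
    obtain ⟨r', hr', hrr'⟩ := exists_lt_of_lt_csSup ⟨0, h0⟩ hrs
    exact (hdown r' r hr' hr hrr'.le).2
  have hs : IsCompact (Metric.closedBall x (sSup S)) := by
    rcases hs0.eq_or_lt with h | h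
    · rw [← h]; exact h0.2
    · exact hX.isCompact_closedBall_of_lt x h hlt
  obtain ⟨δ, hδ, hc⟩ := hX.exists_isCompact_closedBall_add x hs0 hs
  have : sSup S + δ ≤ sSup S := le_csSup hbdd ⟨by positivity, hc⟩
  linarith

end LengthSpace

/-! ### Riemannian distances -/

theorem exists_path_of_dist_lt {E : Type*} [NormedAddCommGroup E] [NormedSpace ℝ E]
    {H : Type*} [TopologicalSpace H] (I : ModelWithCorners ℝ E H)
    {X : Type*} [MetricSpace X] [ChartedSpace H X]
    [Bundle.RiemannianBundle (fun p : X => TangentSpace I p)] [IsRiemannianManifold I X]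
    {x y : X} {r : ℝ} (h : dist x y < r) :
    ∃ γ : ℝ → X, γ 0 = x ∧ γ 1 = y ∧ ContMDiffOn 𝓘(ℝ, ℝ) I 1 γ (Icc 0 1) ∧
      Manifold.pathELength I γ 0 1 < ENNReal.ofReal r := by
  refine Manifold.exists_lt_of_riemannianEDist_lt ?_
  rw [← IsRiemannianManifold.out (I := I) x y, edist_dist]
  exact (ENNReal.ofReal_lt_ofReal_iff_of_nonneg dist_nonneg).2 h

/-- On a curve from `x` to `y` of length less than `r + s`, take a point at distance exactly `r`
from `x`: the curve up to it has length at least `r`, so less than `s` remains. -/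
theorem hasIntermediatePoints_of_isRiemannianManifold {E : Type*} [NormedAddCommGroup E] [NormedSpace ℝ E]
    {H : Type*} [TopologicalSpace H] (I : ModelWithCorners ℝ E H)
    {X : Type*} [MetricSpace X] [ChartedSpace H X]
    [Bundle.RiemannianBundle (fun p : X => TangentSpace I p)] [IsRiemannianManifold I X] : HasIntermediatePoints X := by
  intro x y r s hr hs hxy
  rcases le_or_gt (dist x y) r with hle | hlt
  · exact ⟨y, hle, by simpa using hs⟩
  obtain ⟨γ, h0, h1, hγ, hlen⟩ := exists_path_of_dist_lt I hxy
  have hcont : ContinuousOn (fun u => dist x (γ u)) (Icc (0 : ℝ) 1) :=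
    (continuous_const.dist continuous_id).comp_continuousOn hγ.continuousOn
  obtain ⟨u, hu, hur⟩ : r ∈ (fun u => dist x (γ u)) '' Icc (0 : ℝ) 1 :=
    intermediate_value_Icc zero_le_one hcont ⟨by simpa [h0] using hr, by simpa [h1] using hlt.le⟩
  refine ⟨γ u, hur.le, ?_⟩
  have hA : edist x (γ u) ≤ Manifold.pathELength I γ 0 u := by
    rw [IsRiemannianManifold.out (I := I)]
    exact Manifold.riemannianEDist_le_pathELength
      (hγ.mono (Icc_subset_Icc le_rfl hu.2)) h0 rfl hu.1
  have hB : edist (γ u) y ≤ Manifold.pathELength I γ u 1 := by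
    rw [IsRiemannianManifold.out (I := I)]
    exact Manifold.riemannianEDist_le_pathELength
      (hγ.mono (Icc_subset_Icc hu.1 le_rfl)) rfl h1 hu.2
  have hsum := (add_le_add hA hB).trans_lt
    ((Manifold.pathELength_add (I := I) (γ := γ) hu.1 hu.2).trans_lt hlen)
  rw [edist_dist, edist_dist, ← ENNReal.ofReal_add dist_nonneg dist_nonneg,
    ENNReal.ofReal_lt_ofReal_iff_of_nonneg (by positivity)] at hsum
  simp only at hur
  linarith

/-- Distances in a metric space are finite, so any two points are joined by a curve of finite
length. -/
theorem preconnectedSpace_of_isRiemannianManifold {E : Type*} [NormedAddCommGroup E] [NormedSpace ℝ E]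
    {H : Type*} [TopologicalSpace H] (I : ModelWithCorners ℝ E H)
    {X : Type*} [MetricSpace X] [ChartedSpace H X]
    [Bundle.RiemannianBundle (fun p : X => TangentSpace I p)] [IsRiemannianManifold I X] : PreconnectedSpace X := by
  refine ⟨isPreconnected_of_forall_pair fun x _ y _ => ?_⟩
  obtain ⟨γ, h0, h1, hγ, -⟩ := exists_path_of_dist_lt I (lt_add_one (dist x y))
  exact ⟨γ '' Icc 0 1, subset_univ _, ⟨0, by simp, h0⟩, ⟨1, by simp, h1⟩,
    isPreconnected_Icc.image γ hγ.continuousOn⟩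

/-! ### The second derivative test for the Laplacian -/

section SecondDerivative

/-- A positive second derivative would make `x` a local minimum too, so `h` would be constant near
`x`. -/
theorem deriv_deriv_nonpos_of_isLocalMax {h : ℝ → ℝ} {x : ℝ} (hmax : IsLocalMax h x)
    (hc : ContinuousAt h x) : deriv (deriv h) x ≤ 0 := by
  by_contra! hpos
  have hmin := isLocalMin_of_deriv_deriv_pos hpos hmax.deriv_eq_zero hc
  have hconst : h =ᶠ[𝓝 x] fun _ => h x := by
    filter_upwards [hmax, hmin] with y h1 h2 using le_antisymm h1 h2
  rw [hconst.deriv.deriv_eq] at hpos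
  simp at hpos

variable {E : Type*} [NormedAddCommGroup E] [NormedSpace ℝ E]

theorem differentiableAt_fderiv_apply {F : E → ℝ} {y : E} (hF : ContDiffAt ℝ 2 F y) (v : E) :
    DifferentiableAt ℝ (fun z => fderiv ℝ F z v) y :=
  ((hF.fderiv_right (m := 1) (by norm_num)).differentiableAt (by norm_num)).clm_apply
    (differentiableAt_const v)

theorem eventually_differentiableAt {F : E → ℝ} {y : E} (hF : ContDiffAt ℝ 2 F y) :
    ∀ᶠ z in 𝓝 y, DifferentiableAt ℝ F z :=
  (hF.eventually (by simp)).mono fun _ hz => hz.differentiableAt (by norm_num)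

theorem fderiv_fderiv_nonpos_of_isLocalMax {F : E → ℝ} {y : E} (hF : ContDiffAt ℝ 2 F y)
    (hmax : IsLocalMax F y) (v : E) : fderiv ℝ (fun z => fderiv ℝ F z v) y v ≤ 0 := by
  have hline : ∀ s : ℝ, HasDerivAt (fun s : ℝ => y + s • v) v s := fun s => by
    simpa using ((hasDerivAt_id s).smul_const v).const_add y
  have htend : Tendsto (fun s : ℝ => y + s • v) (𝓝 0) (𝓝 y) := by
    simpa using (hline 0).continuousAt.tendsto
  have hd : deriv (fun s : ℝ => F (y + s • v)) =ᶠ[𝓝 0] fun s => fderiv ℝ F (y + s • v) v := by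
    filter_upwards [htend.eventually (eventually_differentiableAt hF)] with s hs
    exact (hs.hasFDerivAt.comp_hasDerivAt s (hline s)).deriv
  have hdd : deriv (deriv fun s : ℝ => F (y + s • v)) 0
      = fderiv ℝ (fun z => fderiv ℝ F z v) y v := by
    rw [hd.deriv_eq]
    have h := (differentiableAt_fderiv_apply hF v).hasFDerivAt
    have h' : HasFDerivAt (fun z => fderiv ℝ F z v)
        (fderiv ℝ (fun z => fderiv ℝ F z v) y) (y + (0 : ℝ) • v) := by simpa using h
    exact (h'.comp_hasDerivAt (0 : ℝ) (hline 0)).deriv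
  rw [← hdd]
  refine deriv_deriv_nonpos_of_isLocalMax ?_ ?_
  · have := htend.eventually hmax
    filter_upwards [this] with s hs
    simpa using hs
  · have : ContinuousAt F (y + (0 : ℝ) • v) := by simpa using hF.continuousAt
    exact ContinuousAt.comp (f := fun s : ℝ => y + s • v) this (hline 0).continuousAt

theorem fderiv_fderiv_le_of_isLocalMax_sub {F G : E → ℝ} {y : E} (hF : ContDiffAt ℝ 2 F y)
    (hG : ContDiffAt ℝ 2 G y) (hmax : IsLocalMax (fun z => F z - G z) y) (v : E) :
    fderiv ℝ (fun z => fderiv ℝ F z v) y v ≤ fderiv ℝ (fun z => fderiv ℝ G z v) y v := by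
  have h := fderiv_fderiv_nonpos_of_isLocalMax (hF.sub hG) hmax v
  have he : (fun z => fderiv ℝ (fun z => F z - G z) z v)
      =ᶠ[𝓝 y] fun z => fderiv ℝ F z v - fderiv ℝ G z v := by
    filter_upwards [eventually_differentiableAt hF, eventually_differentiableAt hG] with z h1 h2
    rw [fderiv_fun_sub h1 h2]
    rfl
  rw [he.fderiv_eq, fderiv_fun_sub (differentiableAt_fderiv_apply hF v)
    (differentiableAt_fderiv_apply hG v)] at h
  simpa using h

theorem fderiv_eq_of_isLocalMax_sub {F G : E → ℝ} {y : E} (hF : ContDiffAt ℝ 2 F y)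
    (hG : ContDiffAt ℝ 2 G y) (hmax : IsLocalMax (fun z => F z - G z) y) :
    fderiv ℝ F y = fderiv ℝ G y := by
  have h := hmax.fderiv_eq_zero
  rw [fderiv_fun_sub (hF.differentiableAt (by norm_num)) (hG.differentiableAt (by norm_num))] at h
  exact sub_eq_zero.1 h

end SecondDerivative

section Laplacian

variable {n : ℕ} {M : Type*} [MetricSpace M] [ChartedSpace (EuclideanSpace ℝ (Fin n)) M]

theorem contDiffAt_comp_extChartAt_symm {f : M → ℝ} (hf : ContMDiff (𝓡 n) 𝓘(ℝ, ℝ) 2 f) (p : M) :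
    ContDiffAt ℝ 2 (fun y => f ((extChartAt (𝓡 n) p).symm y)) (extChartAt (𝓡 n) p p) := by
  have h := (contMDiffAt_iff.1 (hf p)).2
  rw [ModelWithCorners.range_eq_univ, contDiffWithinAt_univ] at h
  exact h

variable [Bundle.RiemannianBundle (fun p : M => TangentSpace (𝓡 n) p)]

/-- The differentials of `f` and `f'` agree at `p`, so the Christoffel terms of the Hessians cancel
and only second coordinate derivatives along each frame vector are compared. -/
theorem laplacian_le_of_isLocalMax_sub {f f' : M → ℝ} (hf : ContMDiff (𝓡 n) 𝓘(ℝ, ℝ) 2 f)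
    (hf' : ContMDiff (𝓡 n) 𝓘(ℝ, ℝ) 2 f') {p : M} (hmax : IsLocalMax (fun q => f q - f' q) p) :
    laplacian n f p ≤ laplacian n f' p := by
  have hF := contDiffAt_comp_extChartAt_symm hf p
  have hF' := contDiffAt_comp_extChartAt_symm hf' p
  have hmax' : IsLocalMax (fun y => f ((extChartAt (𝓡 n) p).symm y)
      - f' ((extChartAt (𝓡 n) p).symm y)) (extChartAt (𝓡 n) p p) := by
    have h := (continuousAt_extChartAt_symm (I := 𝓡 n) p).tendsto
    rw [extChartAt_to_inv] at h
    filter_upwards [h.eventually hmax] with y hy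
    simpa using hy
  refine Finset.sum_le_sum fun i _ => ?_
  unfold hessian
  rw [fderiv_eq_of_isLocalMax_sub hF hF' hmax']
  exact sub_le_sub_right (fderiv_fderiv_le_of_isLocalMax_sub hF hF' hmax' _) _

end Laplacian

/-! ### Sublevel sets of radial functions -/

namespace EndDecomposition

variable {n : ℕ} {M : Type*} [MetricSpace M] [ChartedSpace (EuclideanSpace ℝ (Fin n)) M]
  {ι : Type*} {N : ι → Type*} [∀ ℓ, TopologicalSpace (N ℓ)]
  [∀ ℓ, ChartedSpace (EuclideanSpace ℝ (Fin (n - 1))) (N ℓ)]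
  (D : EndDecomposition n M N)

/-- The compact complement of the parts `{s > a}` of the ends. -/
def core (a : ℝ) : Set M := (⋃ ℓ, D.param ℓ '' (Ioi a ×ˢ univ))ᶜ

theorem param_mem_endSet (ℓ : ι) {s : ℝ} (hs : 0 < s) (x : N ℓ) :
    D.param ℓ (s, x) ∈ D.endSet ℓ :=
  (D.param ℓ).map_source (by rw [D.source_eq]; exact ⟨hs, mem_univ _⟩)

theorem symm_param (ℓ : ι) {s : ℝ} (hs : 0 < s) (x : N ℓ) :
    (D.param ℓ).symm (D.param ℓ (s, x)) = (s, x) :=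
  (D.param ℓ).left_inv (by rw [D.source_eq]; exact ⟨hs, mem_univ _⟩)

theorem isOpen_endSet (ℓ : ι) : IsOpen (D.endSet ℓ) := (D.param ℓ).open_target

theorem eq_of_mem_endSet {ℓ ℓ' : ι} {p : M} (h : p ∈ D.endSet ℓ) (h' : p ∈ D.endSet ℓ') :
    ℓ = ℓ' := by
  by_contra hne
  exact (D.disjoint hne).ne_of_mem h h' rfl

theorem mem_core_of_notMem {a : ℝ} (ha : 0 < a) {p : M} (hp : ∀ ℓ, p ∉ D.endSet ℓ) :
    p ∈ D.core a := by
  simp only [core, mem_compl_iff, mem_iUnion, not_exists]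
  rintro ℓ ⟨⟨s, x⟩, hs, rfl⟩
  exact hp ℓ (D.param_mem_endSet ℓ (ha.trans hs.1) x)

theorem param_mem_core (ℓ : ι) {a s : ℝ} (hs : 0 < s) (hsa : s ≤ a) (x : N ℓ) :
    D.param ℓ (s, x) ∈ D.core a := by
  simp only [core, mem_compl_iff, mem_iUnion, not_exists]
  rintro ℓ' ⟨⟨s', x'⟩, hs', he⟩
  have hs'0 : 0 < s' := hs.trans_le (hsa.trans (le_of_lt hs'.1))
  obtain rfl : ℓ' = ℓ := D.eq_of_mem_endSet (he ▸ D.param_mem_endSet ℓ' hs'0 x')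
    (D.param_mem_endSet ℓ hs x)
  have h := congrArg (D.param ℓ').symm he
  rw [D.symm_param _ hs'0, D.symm_param _ hs] at h
  have h1 : s' = s := congrArg Prod.fst h
  have h2 : a < s' := hs'.1
  linarith

theorem frontier_endSet_subset_core (ℓ : ι) {a : ℝ} (ha : 0 < a) :
    frontier (D.endSet ℓ) ⊆ D.core a := by
  intro p hp
  refine D.mem_core_of_notMem ha fun ℓ' hℓ' => ?_
  rcases eq_or_ne ℓ ℓ' with rfl | hne
  · exact (D.isOpen_endSet ℓ).inter_frontier_eq.subset ⟨hℓ', hp⟩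
  · exact ((D.disjoint hne).closure_left (D.isOpen_endSet ℓ')).ne_of_mem
      (frontier_subset_closure hp) hℓ' rfl

/-- If one end were all of `M`, its coordinate `s` would attain a positive minimum on the compact
core, which contains points with `s` arbitrarily small. Properness of the end makes its frontier
nonempty, without which `Metric.infDist` to it would be the default value `0`. -/
theorem endSet_ne_univ [∀ ℓ, Nonempty (N ℓ)] (ℓ : ι) : D.endSet ℓ ≠ univ := by
  intro huniv
  obtain ⟨x⟩ := ‹∀ ℓ, Nonempty (N ℓ)› ℓ
  have hcont : ContinuousOn (fun p => ((D.param ℓ).symm p).1) (D.core 1) :=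
    (continuous_fst.comp_continuousOn (D.param ℓ).continuousOn_symm).mono
      fun p _ => huniv.symm.subset (mem_univ p)
  obtain ⟨p, -, hp⟩ := (D.compact_core 1 one_pos).exists_isMinOn
    ⟨_, D.param_mem_core ℓ one_pos le_rfl x⟩ hcont
  have hpos : 0 < ((D.param ℓ).symm p).1 := by
    have h := (D.param ℓ).map_target (huniv.symm.subset (mem_univ p))
    rw [D.source_eq] at h
    exact h.1
  set m := ((D.param ℓ).symm p).1
  -- This value of `s` is below the supposed minimum `m` and below `1`, hence still in the core.
  have hm : 0 < min m 1 / 2 := by positivity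
  have h := hp (D.param_mem_core ℓ hm (by linarith [min_le_right m 1]) x)
  simp only [mem_ofPred_eq, D.symm_param ℓ hm x] at h
  linarith [min_le_left m 1, show m ≤ min m 1 / 2 from h]

theorem frontier_endSet_nonempty [PreconnectedSpace M] [∀ ℓ, Nonempty (N ℓ)] (ℓ : ι) :
    (frontier (D.endSet ℓ)).Nonempty := by
  obtain ⟨x⟩ := ‹∀ ℓ, Nonempty (N ℓ)› ℓ
  exact nonempty_frontier_iff.2
    ⟨⟨_, D.param_mem_endSet ℓ one_pos x⟩, D.endSet_ne_univ ℓ⟩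

theorem IsRadial.isBounded_sublevel [PreconnectedSpace M] [Finite ι] [∀ ℓ, Nonempty (N ℓ)]
    {D : EndDecomposition n M N} {t : M → ℝ} (ht : D.IsRadial t) (A : ℝ) :
    Bornology.IsBounded {p | t p ≤ A} := by
  have hcore : Bornology.IsBounded (D.core 1) := (D.compact_core 1 one_pos).isBounded
  have hend : ∀ ℓ, Bornology.IsBounded {p | p ∈ D.endSet ℓ ∧ t p ≤ A} := by
    intro ℓ
    obtain ⟨C₁, C₂, hC₁, hC, hcomp⟩ := ht.comparable ℓ
    refine (Bornology.IsBounded.subset hcore (D.frontier_endSet_subset_core ℓ one_pos)).cthickening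
      (δ := C₂ * (1 + A)) |>.subset fun p hp => ?_
    have hne := D.frontier_endSet_nonempty ℓ
    have h1 := (hcomp p hp.1).2
    have h2 : C₂ * (1 + t p) ≤ C₂ * (1 + A) :=
      mul_le_mul_of_nonneg_left (by linarith [hp.2]) (hC₁.trans hC).le
    have h3 := (Metric.infDist_nonneg (x := p) (s := frontier (D.endSet ℓ)))
    rw [Metric.mem_cthickening_iff, ENNReal.le_ofReal_iff_toReal_le (Metric.infEDist_ne_top hne)
      (by linarith)]
    exact (by linarith : Metric.infDist p (frontier (D.endSet ℓ)) ≤ C₂ * (1 + A))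
  refine (hcore.union (Bornology.isBounded_iUnion.2 hend)).subset fun p hp => ?_
  by_cases h : ∃ ℓ, p ∈ D.endSet ℓ
  · obtain ⟨ℓ, hℓ⟩ := h
    exact Or.inr (mem_iUnion.2 ⟨ℓ, hℓ, hp⟩)
  · exact Or.inl (D.mem_core_of_notMem one_pos (not_exists.1 h))

theorem IsRadial.isCompact_superlevel [PreconnectedSpace M] [ProperSpace M] [Finite ι]
    [∀ ℓ, Nonempty (N ℓ)] {D : EndDecomposition n M N} {t : M → ℝ} (ht : D.IsRadial t)
    {κ C ε : ℝ} (hκ : 0 < κ) (hε : 0 < ε) {w : M → ℝ} (hw : Continuous w)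
    (hdecay : ∀ p, |Real.exp (κ * t p) * w p| ≤ C) : IsCompact {p | ε ≤ w p} := by
  refine Metric.isCompact_of_isClosed_isBounded (isClosed_le continuous_const hw)
    ((ht.isBounded_sublevel (C / (ε * κ))).subset fun p (hp : ε ≤ w p) => ?_)
  have h1 : Real.exp (κ * t p) * w p ≤ C := (le_abs_self _).trans (hdecay p)
  -- The linear bound `x ≤ exp x` suffices and avoids a logarithm of `C / ε`.
  have h2 : κ * t p * ε ≤ C :=
    calc κ * t p * ε ≤ Real.exp (κ * t p) * ε :=
          mul_le_mul_of_nonneg_right (by linarith [Real.add_one_le_exp (κ * t p)]) hε.le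
      _ ≤ Real.exp (κ * t p) * w p := mul_le_mul_of_nonneg_left hp (Real.exp_pos _).le
      _ ≤ C := h1
  simp only [mem_ofPred_eq]
  rw [le_div_iff₀ (by positivity)]
  linarith

end EndDecomposition

/-! ### The comparison principle -/

theorem exists_isMax_of_isCompact_superlevel {X : Type*} [TopologicalSpace X] {w : X → ℝ}
    (hw : Continuous w) {q : X} (hK : IsCompact {p | w q ≤ w p}) : ∃ p, ∀ p', w p' ≤ w p := by
  obtain ⟨p, hp, hmax⟩ := hK.exists_isMaxOn ⟨q, le_refl (w q)⟩ hw.continuousOn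
  refine ⟨p, fun p' => ?_⟩
  rcases le_total (w q) (w p') with h | h
  · exact hmax h
  · exact h.trans hp

variable {n : ℕ} {M : Type*} [MetricSpace M] [ChartedSpace (EuclideanSpace ℝ (Fin n)) M]
  [Bundle.RiemannianBundle (fun p : M => TangentSpace (𝓡 n) p)]

theorem SolvesLichnerowicz.le_of_isMax_sub (hn : 3 ≤ n) {β : M → ℝ}
    {S : ∀ p : M, TangentSpace (𝓡 n) p →ₗ[ℝ] TangentSpace (𝓡 n) p →ₗ[ℝ] ℝ} {φ ψ : M → ℝ}
    (hφ : SolvesLichnerowicz n β S φ) (hψ : SolvesLichnerowicz n β S ψ)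
    (hφc : ContMDiff (𝓡 n) 𝓘(ℝ, ℝ) 2 φ) (hψc : ContMDiff (𝓡 n) 𝓘(ℝ, ℝ) 2 ψ) {p : M}
    (hpos : 0 < φ p) (hβ : 0 ≤ β p) (hR : 0 < scalarCurvature n p)
    (hmax : ∀ q, ψ q - φ q ≤ ψ p - φ p) : ψ p ≤ φ p := by
  by_contra! hlt
  have hΔ : laplacian n ψ p ≤ laplacian n φ p :=
    laplacian_le_of_isLocalMax_sub hψc hφc (Eventually.of_forall hmax)
  have hn' : (3 : ℝ) ≤ n := by exact_mod_cast hn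
  have e1 := hφ p
  have e2 := hψ p
  have hc : 0 < ((n : ℝ) - 2) / (4 * ((n : ℝ) - 1)) := div_pos (by linarith) (by linarith)
  have hα : 0 ≤ ((n : ℝ) + 2) / ((n : ℝ) - 2) := div_nonneg (by linarith) (by linarith)
  have hγ : 0 ≤ (3 * (n : ℝ) - 2) / ((n : ℝ) - 2) := div_nonneg (by linarith) (by linarith)
  have h1 := mul_pos (mul_pos hc hR) (sub_pos.2 hlt)
  have h2 := mul_le_mul_of_nonneg_left (Real.rpow_le_rpow hpos.le hlt.le hα) hβ
  have hS : 0 ≤ normSq n S p := Finset.sum_nonneg fun i _ => Finset.sum_nonneg fun j _ => sq_nonneg _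
  have h3 := mul_le_mul_of_nonneg_left
    (Real.rpow_le_rpow_of_nonpos hpos hlt.le (neg_nonpos.2 hγ)) (mul_nonneg hc.le hS)
  linarith

end LichUnique

/-! ### Uniqueness for the Lichnerowicz equation -/

theorem proposition3p2 (n : ℕ) (hn : 3 ≤ n)
    -- the complete Riemannian manifold `M`
    (M : Type*) [MetricSpace M] [CompleteSpace M]
    [ChartedSpace (EuclideanSpace ℝ (Fin n)) M] [IsManifold (𝓡 n) ∞ M]
    [Bundle.RiemannianBundle (fun p : M => TangentSpace (𝓡 n) p)]
    [IsContMDiffRiemannianBundle (𝓡 n) ∞ (EuclideanSpace ℝ (Fin n))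
      (fun p : M => TangentSpace (𝓡 n) p)]
    [IsRiemannianManifold (𝓡 n) M]
    -- the closed cross-sections `N ℓ` of its finitely many ends
    {ι : Type*} [Finite ι] (N : ι → Type*)
    [∀ ℓ, TopologicalSpace (N ℓ)] [∀ ℓ, T2Space (N ℓ)] [∀ ℓ, CompactSpace (N ℓ)]
    [∀ ℓ, Nonempty (N ℓ)]
    [∀ ℓ, ChartedSpace (EuclideanSpace ℝ (Fin (n - 1))) (N ℓ)]
    [∀ ℓ, IsManifold (𝓡 (n - 1)) ∞ (N ℓ)]
    (D : LichUnique.EndDecomposition n M N)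
    -- every end is asymptotically cylindrical or asymptotically periodic
    (T : ι → ℝ) (hT : ∀ ℓ, 0 < T ℓ) (hends : ∀ ℓ, D.IsAC ℓ ∨ D.IsAP ℓ (T ℓ))
    (t : M → ℝ) (ht : D.IsRadial t)
    -- the scalar curvature and `β` have positive lower bounds
    (R₀ : ℝ) (hR₀ : 0 < R₀) (hR : ∀ p : M, R₀ ≤ LichUnique.scalarCurvature n p)
    (τ : M → ℝ) (Lam : ℝ) (hLam : 0 ≤ Lam)
    (β₀ : ℝ) (hβ₀ : 0 < β₀) (hβ : ∀ p : M, β₀ ≤ LichUnique.betaFn n τ Lam p)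
    -- the symmetric tensor whose squared norm converges on the ends
    (S : ∀ p : M, TangentSpace (𝓡 n) p →ₗ[ℝ] TangentSpace (𝓡 n) p →ₗ[ℝ] ℝ)
    (hS : ∀ p u v, S p u v = S p v u)
    (κ : ℝ) (hκ : 0 < κ)
    (hSlim : ∀ ℓ, D.ConvergesOnEnd ℓ (T ℓ) t κ (LichUnique.normSq n S))
    -- the two solutions
    (μ : ℝ) (hμ₀ : 0 < μ) (hμ₁ : μ < 1)
    (φ₁ φ₂ : M → ℝ) (hφ₁ : LichUnique.MemHolder n μ φ₁) (hφ₂ : LichUnique.MemHolder n μ φ₂)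
    (hpos₁ : ∃ ε : ℝ, 0 < ε ∧ ∀ p, ε ≤ φ₁ p) (hpos₂ : ∃ ε : ℝ, 0 < ε ∧ ∀ p, ε ≤ φ₂ p)
    (hsol₁ : LichUnique.SolvesLichnerowicz n (LichUnique.betaFn n τ Lam) S φ₁)
    (hsol₂ : LichUnique.SolvesLichnerowicz n (LichUnique.betaFn n τ Lam) S φ₂)
    (hdiff : LichUnique.MemWeightedHolder n t μ (-κ) (fun p => φ₂ p - φ₁ p)) :
    φ₁ = φ₂ := by
  have : PreconnectedSpace M := LichUnique.preconnectedSpace_of_isRiemannianManifold (𝓡 n)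
  have : LocallyCompactSpace M := Manifold.locallyCompact_of_finiteDimensional (𝓡 n)
  have : ProperSpace M :=
    (LichUnique.hasIntermediatePoints_of_isRiemannianManifold (𝓡 n)).properSpace
  -- The bound on `ψ - φ` is symmetric in the two functions, so this one-sided comparison applies in
  -- both orders.
  have key : ∀ φ ψ : M → ℝ, ContMDiff (𝓡 n) 𝓘(ℝ, ℝ) 2 φ → ContMDiff (𝓡 n) 𝓘(ℝ, ℝ) 2 ψ →
      (∀ p, 0 < φ p) → LichUnique.SolvesLichnerowicz n (LichUnique.betaFn n τ Lam) S φ →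
      LichUnique.SolvesLichnerowicz n (LichUnique.betaFn n τ Lam) S ψ →
      (∃ C, ∀ p, |Real.exp (κ * t p) * (ψ p - φ p)| ≤ C) → ∀ q, ψ q ≤ φ q := by
    rintro φ ψ hφ hψ hpos hφs hψs ⟨C, hC⟩ q
    by_contra! hq
    have hcont : Continuous fun p => ψ p - φ p := hψ.continuous.sub hφ.continuous
    obtain ⟨p, hp⟩ := LichUnique.exists_isMax_of_isCompact_superlevel hcont
      (ht.isCompact_superlevel hκ (sub_pos.2 hq) hcont hC)
    have := hφs.le_of_isMax_sub hn hψs hφ hψ (hpos p) (hβ₀.le.trans (hβ p))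
      (hR₀.trans_le (hR p)) hp
    linarith [hp q]
  obtain ⟨-, C, hC, -⟩ := hdiff
  simp only [neg_neg] at hC
  obtain ⟨ε₁, hε₁, h₁⟩ := hpos₁
  obtain ⟨ε₂, hε₂, h₂⟩ := hpos₂
  refine funext fun q => le_antisymm ?_ ?_
  · refine key φ₂ φ₁ hφ₂.1 hφ₁.1 (fun p => hε₂.trans_le (h₂ p)) hsol₂ hsol₁ ⟨C, fun p => ?_⟩ q
    have h := hC p
    rwa [← abs_neg, ← mul_neg, neg_sub] at h
  · exact key φ₁ φ₂ hφ₁.1 hφ₂.1 (fun p => hε₁.trans_le (h₁ p)) hsol₁ hsol₂ ⟨C, hC⟩ q
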